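/- Let $d,m\ge 2$. For a real $n\times n$ matrix $A$ and $r>0$ put $r^A=\exp((\ln r)A)$, and let $Q(\mathbb R^n)$ be the set of invertible real $n\times n$ matrices all of whose (complex) eigenvalues have positive real part. Equality in distribution $\stackrel{d}{=}$ of random fields means equality of all finite-dimensional distributions. Let $X=\{X(t),\,t\in\mathbb R^d\}$ be an $\mathbb R^m$-valued random field which is stochastically continuous (i.e. $X(s)\to X(t)$ in probability as $s\to t$, for every $t$) and proper (i.e. for every $t\neq 0$ the support of the distribution of $X(t)$ is not contained in any affine hyperplane of $\mathbb R^m$). Suppose that $X$ is wide-sense operator-self-similar with exponents $(E,D)$, that is, $E\in Q(\mathbb R^d)$, $D$ is a real $m\times m$ matrix, and there are non-random functions $b_r:\mathbb R^d\to\mathbb R^m$, $r>0$, with $$\{X(r^Et),\ t\in\mathbb R^d\}\stackrel{d}{=}\{r^DX(t)+b_r(t),\ t\in\mathbb R^d\}\qquad\text{for every } r>0 .$$ Let $\lambda>0$ be a positive eigenvalue of $E$ and let $\xi\in\mathbb R^d$ satisfy $E\xi=\lambda\xi$. Then there is a function $f:\mathbb R\setminus\{0\}\to\mathbb R^m$ with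 the following properties. (i) $f$ is continuous on $\mathbb R\setminus\{0\}$, and $$b_r(u\xi)=f(ur^\lambda)-r^Df(u)\qquad\text{for all } u\in\mathbb R\setminus\{0\},\ r>0 .$$ (ii) If $D\in Q(\mathbb R^m)$, then $f$ extends to a continuous function on $\mathbb R$ (still denoted $f$) such that the process $Y(u)=X(u\xi)-f(u)$, $u\in\mathbb R$, is operator-self-similar with exponent $D/\lambda$: $$\{Y(ru),\ u\in\mathbb R\}\stackrel{d}{=}\{r^{D/\lambda}Y(u),\ u\in\mathbb R\}\qquad\text{for every } r>0 .$$ -/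

import Mathlib

open MeasureTheory ProbabilityTheory Filter Topology

noncomputable section

namespace OpSelfSimilar

/-- The operator `r ^ A = exp ((ln r) A)` on `ℝⁿ`, for a real matrix `A` and `r > 0`. -/
def opPow {n : ℕ} (r : ℝ) (A : Matrix (Fin n) (Fin n) ℝ) :
    EuclideanSpace ℝ (Fin n) →L[ℝ] EuclideanSpace ℝ (Fin n) :=
  Matrix.toEuclideanCLM (𝕜 := ℝ) (NormedSpace.exp (Real.log r • A))

/-- The class `Q(ℝⁿ)`: invertible matrices all of whose (complex) eigenvalues have positive
real part. -/
def MemQ {n : ℕ} (A : Matrix (Fin n) (Fin n) ℝ) : Prop :=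
  IsUnit A ∧ ∀ z ∈ spectrum ℂ (A.map (algebraMap ℝ ℂ)), 0 < z.re

/-- A measure on `ℝᵐ` is full if its support is not contained in any affine hyperplane. -/
def IsFull {m : ℕ} (ν : Measure (EuclideanSpace ℝ (Fin m))) : Prop :=
  ∀ y : EuclideanSpace ℝ (Fin m), y ≠ 0 → ∀ c : ℝ, ¬ ν.support ⊆ {x | inner ℝ y x = c}

variable {Ω : Type*} [MeasurableSpace Ω]

/-- Equality in law of two `ℝᵐ`-valued processes over an index set `T`: the laws on the path space
with the product σ-algebra agree (equivalently, all finite-dimensional distributions agree). -/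
def EqInLaw {T : Type*} {m : ℕ} (P : Measure Ω) (X Y : T → Ω → EuclideanSpace ℝ (Fin m)) : Prop :=
  IdentDistrib (fun ω t => X t ω) (fun ω t => Y t ω) P P

/-- Stochastic continuity: `X s → X t` in probability as `s → t`, for every `t`. -/
def StochasticallyContinuous {d m : ℕ} (P : Measure Ω)
    (X : EuclideanSpace ℝ (Fin d) → Ω → EuclideanSpace ℝ (Fin m)) : Prop :=
  ∀ t, TendstoInMeasure P X (𝓝 t) (X t)

/-- A random field is proper if the law of `X t` is full for every `t ≠ 0`. -/
def IsProper {d m : ℕ} (P : Measure Ω)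
    (X : EuclideanSpace ℝ (Fin d) → Ω → EuclideanSpace ℝ (Fin m)) : Prop :=
  ∀ t, t ≠ 0 → IsFull (P.map (X t))

/-- `X` is wide-sense operator-self-similar with exponents `(E, D)` and (non-random) shift
functions `b r`: `E ∈ Q(ℝᵈ)` and `{X(r^E t)} = {r^D X(t) + b_r(t)}` in law for every `r > 0`. -/
structure IsWOSS {d m : ℕ} (P : Measure Ω)
    (X : EuclideanSpace ℝ (Fin d) → Ω → EuclideanSpace ℝ (Fin m))
    (E : Matrix (Fin d) (Fin d) ℝ) (D : Matrix (Fin m) (Fin m) ℝ)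
    (b : ℝ → EuclideanSpace ℝ (Fin d) → EuclideanSpace ℝ (Fin m)) : Prop where
  memQ : MemQ E
  eqInLaw : ∀ r : ℝ, 0 < r →
    EqInLaw P (fun t => X (opPow r E t)) (fun t ω => opPow r D (X t ω) + b r t)

/-- A one-parameter process `Y` indexed by `ℝ` is operator-self-similar with exponent `H`:
`{Y(r u)} = {r^H Y(u)}` in law for every `r > 0`. -/
def IsOneParamOSS {m : ℕ} (P : Measure Ω) (Y : ℝ → Ω → EuclideanSpace ℝ (Fin m))
    (H : Matrix (Fin m) (Fin m) ℝ) : Prop :=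
  ∀ r : ℝ, 0 < r → EqInLaw P (fun u => Y (r * u)) (fun u ω => opPow r H (Y u ω))

end OpSelfSimilar

end

noncomputable section

namespace OpSelfSimilar

/-! The shifts are recovered from the laws by a location functional `center` that needs no moments:
in each coordinate, the zero `c` of the mean of `arctan (x - c)`. It depends only on the law,
commutes with translations and is continuous under convergence in distribution
(`tendsto_arctanCenter`). Applied to self-similarity it gives `b_r(t) = center X(r^E t) - center
(r^D X(t))` (`IsWOSS.shift_eq`), so `b` is continuous in `t` and in `r`, and it gives the cocycle
identity `b_{rs}(t) = r^D b_s(t) + b_r(s^E t)` (`IsWOSS.shift_mul`).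

On the eigenline, `r^E` multiplies by `r^λ`, so every `u ξ` with `u ≠ 0` lies on the orbit of `ξ` or
`-ξ`. Setting `f(u) = b_s(sign(u) ξ)` with `s = |u|^{1/λ}` turns the cocycle identity into the
coboundary formula.

If `D` lies in `Q`, then `r^D → 0` pointwise as `r → 0` (`tendsto_opPow_apply`), hence `f(u) →
center X(0)` as `u → 0`. The extended function satisfies the coboundary formula at `0` too, by
continuity, and subtracting it cancels the shifts. -/

theorem tendsto_pow_mul_cexp_atBot {z : ℂ} (hz : 0 < z.re) (j : ℕ) :
    Tendsto (fun t : ℝ => (t : ℂ) ^ j * Complex.exp (t * z)) atBot (𝓝 0) := by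
  rw [tendsto_zero_iff_norm_tendsto_zero]
  have h := (tendsto_rpow_mul_exp_neg_mul_atTop_nhds_zero j z.re hz).comp
    (tendsto_neg_atBot_atTop (G := ℝ))
  refine h.congr' ?_
  filter_upwards [eventually_le_atBot 0] with t ht
  simp [Complex.norm_exp, abs_of_nonpos ht, mul_comm]

/-! ### Decay of complex linear flows at time `-∞`. -/

section Flow

variable {V : Type*} [NormedAddCommGroup V] [NormedSpace ℂ V]

theorem exp_apply_eq_sum [CompleteSpace V] (N : V →L[ℂ] V) {k : ℕ} {v : V}
    (hv : (N ^ k) v = 0) :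
    NormedSpace.exp N v = ∑ j ∈ Finset.range k, ((j.factorial : ℂ)⁻¹) • (N ^ j) v := by
  have h := (NormedSpace.exp_series_hasSum_exp' (𝕂 := ℂ) N).mapL
    (ContinuousLinearMap.apply ℂ V v)
  refine h.unique (hasSum_sum_of_ne_finset_zero fun j hj => ?_)
  rw [Finset.mem_range, not_lt] at hj
  have : (N ^ j) v = 0 := by
    rw [← Nat.sub_add_cancel hj, pow_add, mul_apply_eq_comp, hv, map_zero]
  simp [this]

theorem exp_smul_one_apply [CompleteSpace V] (c : ℂ) (v : V) :
    NormedSpace.exp (c • (1 : V →L[ℂ] V)) v = Complex.exp c • v := by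
  have := NormedSpace.algebraMap_exp_comm (𝕂 := ℂ) (𝔸 := V →L[ℂ] V) c
  rw [Algebra.algebraMap_eq_smul_one, Algebra.algebraMap_eq_smul_one] at this
  rw [← this, Complex.exp_eq_exp_ℂ]
  simp

/-- Split `T` as `z` plus `T - z`: the two commute, and the exponential series of the second,
applied to `v`, stops before degree `k`. -/
theorem exp_smul_apply_genEigenvector [CompleteSpace V] (T : V →L[ℂ] V) {z : ℂ} {k : ℕ} {v : V}
    (hv : ((T - z • 1) ^ k) v = 0) (t : ℂ) :
    NormedSpace.exp (t • T) v = ∑ j ∈ Finset.range k,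
      (t ^ j * Complex.exp (t * z)) • ((j.factorial : ℂ)⁻¹ • ((T - z • 1) ^ j) v) := by
  have hsplit : t • T = (t * z) • (1 : V →L[ℂ] V) + t • (T - z • 1) := by
    rw [smul_sub, smul_smul]; abel
  have hcomm : Commute ((t * z) • (1 : V →L[ℂ] V)) (t • (T - z • 1)) :=
    (Commute.one_left _).smul_left _
  let : NormedAlgebra ℚ (V →L[ℂ] V) := NormedAlgebra.restrictScalars ℚ ℂ _
  rw [hsplit, NormedSpace.exp_add_of_commute hcomm, mul_apply_eq_comp,
    exp_smul_one_apply, exp_apply_eq_sum (k := k), Finset.smul_sum]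
  · refine Finset.sum_congr rfl fun j _ => ?_
    rw [smul_pow, smul_apply, smul_smul, smul_smul, smul_smul]
    congr 1; ring
  · rw [smul_pow, smul_apply, hv, smul_zero]

theorem tendsto_exp_smul_apply_atBot [FiniteDimensional ℂ V] (T : V →L[ℂ] V)
    (hT : ∀ z ∈ spectrum ℂ (T : V →ₗ[ℂ] V), 0 < z.re) (v : V) :
    Tendsto (fun t : ℝ => NormedSpace.exp ((t : ℂ) • T) v) atBot (𝓝 0) := by
  have : CompleteSpace V := FiniteDimensional.complete ℂ V
  have hv : v ∈ ⨆ z, Module.End.maxGenEigenspace (T : V →ₗ[ℂ] V) z := by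
    rw [Module.End.iSup_maxGenEigenspace_eq_top]; trivial
  induction hv using Submodule.iSup_induction' with
  | zero => simp
  | add x y _ _ hx hy => simpa using hx.add hy
  | mem z x hx =>
    rw [Module.End.mem_maxGenEigenspace] at hx
    obtain ⟨k, hk⟩ := hx
    -- Only a nonzero generalized eigenvector forces `z` into the spectrum.
    by_cases hx0 : x = 0
    · simp [hx0]
    have hz : 0 < z.re := by
      refine hT z (Module.End.HasEigenvalue.mem_spectrum ?_)
      refine Module.End.hasEigenvalue_of_hasGenEigenvalue (k := k) ?_
      rw [Module.End.HasGenEigenvalue, Module.End.HasUnifEigenvalue, Submodule.ne_bot_iff]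
      exact ⟨x, by rwa [Module.End.mem_genEigenspace_nat], hx0⟩
    have hk' : ((T - z • 1) ^ k) x = 0 := by
      have hpow : ((((T - z • 1 : V →L[ℂ] V)) ^ k : V →L[ℂ] V) : V →ₗ[ℂ] V)
          = ((T : V →ₗ[ℂ] V) - z • 1) ^ k := by
        simp
      rw [← hk, ← hpow]; rfl
    simp_rw [exp_smul_apply_genEigenvector T hk']
    rw [← Finset.sum_const_zero (s := Finset.range k)]
    refine tendsto_finsetSum _ fun j _ => ?_
    simpa using (tendsto_pow_mul_cexp_atBot hz j).smul_const
      ((j.factorial : ℂ)⁻¹ • ((T - z • 1) ^ j) x)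

end Flow

/-! ### The operators `r^A`: multiplicativity, continuity, eigenvectors, limit at `0`. -/

section OpPow

variable {n : ℕ}

/-- The continuous linear operator on `ℝⁿ` given by a real matrix. -/
def toOperator (A : Matrix (Fin n) (Fin n) ℝ) :
    EuclideanSpace ℝ (Fin n) →L[ℝ] EuclideanSpace ℝ (Fin n) :=
  Matrix.toEuclideanCLM (𝕜 := ℝ) A

/-- The exponential of a matrix depends only on the topology, so an operator norm may be installed
locally to invoke the normed-algebra result. -/
theorem map_exp_matrix {𝕜 B : Type*} [RCLike 𝕜] [NormedRing B] [NormedAlgebra ℚ B]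
    (φ : Matrix (Fin n) (Fin n) 𝕜 →+* B) (hφ : Continuous φ) (A : Matrix (Fin n) (Fin n) 𝕜) :
    φ (NormedSpace.exp A) = NormedSpace.exp (φ A) := by
  let i₁ : NormedRing (Matrix (Fin n) (Fin n) 𝕜) := Matrix.linftyOpNormedRing
  let i₂ : NormedAlgebra 𝕜 (Matrix (Fin n) (Fin n) 𝕜) := Matrix.linftyOpNormedAlgebra
  let i₃ : NormedAlgebra ℚ (Matrix (Fin n) (Fin n) 𝕜) := NormedAlgebra.restrictScalars ℚ 𝕜 _
  have i₄ : @CompleteSpace (Matrix (Fin n) (Fin n) 𝕜) i₁.toPseudoMetricSpace.toUniformSpace :=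
    @FiniteDimensional.complete 𝕜 (Matrix (Fin n) (Fin n) 𝕜) _ _ _ _ _ _ _ _ _
  exact @NormedSpace.map_exp _ _ i₁ i₃ i₄ _ _ _ _ _ φ hφ A

theorem toEuclideanCLM_exp {𝕜 : Type*} [RCLike 𝕜] (A : Matrix (Fin n) (Fin n) 𝕜) :
    Matrix.toEuclideanCLM (𝕜 := 𝕜) (NormedSpace.exp A)
      = NormedSpace.exp (Matrix.toEuclideanCLM (𝕜 := 𝕜) A) := by
  let : NormedAlgebra ℚ (EuclideanSpace 𝕜 (Fin n) →L[𝕜] EuclideanSpace 𝕜 (Fin n)) :=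
    NormedAlgebra.restrictScalars ℚ 𝕜 _
  exact map_exp_matrix
    (Matrix.toEuclideanCLM (n := Fin n) (𝕜 := 𝕜)).toAlgEquiv.toAlgHom.toRingHom
    (LinearMap.continuous_of_finiteDimensional
      (Matrix.toEuclideanCLM (n := Fin n) (𝕜 := 𝕜)).toAlgEquiv.toLinearMap) A

theorem opPow_eq_exp (r : ℝ) (A : Matrix (Fin n) (Fin n) ℝ) :
    opPow r A = NormedSpace.exp (Real.log r • toOperator A) :=
  (toEuclideanCLM_exp (Real.log r • A)).trans
    (congrArg NormedSpace.exp (map_smul Matrix.toEuclideanCLM (Real.log r) A))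

theorem exp_add_smul {𝔸 : Type*} [NormedRing 𝔸] [NormedAlgebra ℝ 𝔸] [CompleteSpace 𝔸] (a b : ℝ)
    (T : 𝔸) : NormedSpace.exp ((a + b) • T) = NormedSpace.exp (a • T) * NormedSpace.exp (b • T) := by
  let : NormedAlgebra ℚ 𝔸 := NormedAlgebra.restrictScalars ℚ ℝ _
  rw [add_smul, NormedSpace.exp_add_of_commute]
  exact ((Commute.refl T).smul_left a).smul_right b

theorem opPow_mul_apply {r s : ℝ} (hr : 0 < r) (hs : 0 < s) (A : Matrix (Fin n) (Fin n) ℝ)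
    (x : EuclideanSpace ℝ (Fin n)) : opPow (r * s) A x = opPow r A (opPow s A x) := by
  rw [opPow_eq_exp, opPow_eq_exp, opPow_eq_exp, Real.log_mul hr.ne' hs.ne']
  exact congrArg (fun T : EuclideanSpace ℝ (Fin n) →L[ℝ] EuclideanSpace ℝ (Fin n) => T x)
    (exp_add_smul (Real.log r) (Real.log s) (toOperator A))

theorem opPow_smul (r c : ℝ) (A : Matrix (Fin n) (Fin n) ℝ) (hr : 0 < r) :
    opPow r (c • A) = opPow (r ^ c) A := by
  rw [opPow, opPow, Real.log_rpow hr, smul_smul, mul_comm]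

theorem continuousOn_opPow (A : Matrix (Fin n) (Fin n) ℝ) :
    ContinuousOn (fun r => opPow r A) (Set.Ioi 0) := by
  simp_rw [opPow_eq_exp]
  let : NormedAlgebra ℚ (EuclideanSpace ℝ (Fin n) →L[ℝ] EuclideanSpace ℝ (Fin n)) :=
    NormedAlgebra.restrictScalars ℚ ℝ _
  refine NormedSpace.exp_continuous.comp_continuousOn (g := NormedSpace.exp)
    (f := fun r => Real.log r • toOperator A) ?_
  refine ContinuousOn.smul (f := Real.log) ?_ continuousOn_const
  exact Real.continuousOn_log.mono fun r hr => ne_of_gt hr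

theorem opPow_apply_eigenvector {A : Matrix (Fin n) (Fin n) ℝ} {lam : ℝ}
    {x : EuclideanSpace ℝ (Fin n)} (hx : Matrix.toEuclideanCLM (𝕜 := ℝ) A x = lam • x)
    {r : ℝ} (hr : 0 < r) : opPow r A x = r ^ lam • x := by
  set T := toOperator A
  replace hx : T x = lam • x := hx
  have hpow (j : ℕ) : ((Real.log r • T) ^ j) x = (Real.log r * lam) ^ j • x := by
    induction j with
    | zero => simp
    | succ j ih =>
      rw [pow_succ', mul_apply_eq_comp, ih, map_smul, smul_apply,
        hx, smul_smul, smul_smul]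
      congr 1; ring
  have h := (NormedSpace.exp_series_hasSum_exp' (𝕂 := ℝ) (Real.log r • T)).mapL
    (ContinuousLinearMap.apply ℝ _ x)
  have h' := (NormedSpace.exp_series_hasSum_exp' (𝕂 := ℝ) (Real.log r * lam)).smul_const x
  rw [← Real.exp_eq_exp_ℝ, ← Real.rpow_def_of_pos hr] at h'
  rw [opPow_eq_exp]
  refine h.unique ?_
  refine h'.congr_fun fun j => ?_
  rw [ContinuousLinearMap.apply_apply, smul_apply, hpow, smul_assoc]

/-- Complexify, apply the decay of the flow at time `log r → -∞`, and take real parts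
coordinatewise. -/
theorem tendsto_opPow_apply {A : Matrix (Fin n) (Fin n) ℝ} (hA : MemQ A)
    (x : EuclideanSpace ℝ (Fin n)) :
    Tendsto (fun r => opPow r A x) (𝓝[>] 0) (𝓝 0) := by
  set B := A.map (algebraMap ℝ ℂ)
  set y : EuclideanSpace ℂ (Fin n) := WithLp.toLp 2 fun i => (x i : ℂ)
  have hB : ∀ z ∈ spectrum ℂ (Matrix.toEuclideanCLM (𝕜 := ℂ) B :
      EuclideanSpace ℂ (Fin n) →ₗ[ℂ] EuclideanSpace ℂ (Fin n)), 0 < z.re := by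
    intro z hz
    rw [Matrix.coe_toEuclideanCLM_eq_toEuclideanLin, Matrix.spectrum_toLpLin] at hz
    exact hA.2 z hz
  have hlim := (tendsto_exp_smul_apply_atBot _ hB y).comp Real.tendsto_log_nhdsGT_zero
  have hmap (M : Matrix (Fin n) (Fin n) ℝ) :
      (NormedSpace.exp M).map (algebraMap ℝ ℂ) = NormedSpace.exp (M.map (algebraMap ℝ ℂ)) := by
    let i₁ : NormedRing (Matrix (Fin n) (Fin n) ℂ) := Matrix.linftyOpNormedRing
    let i₂ : NormedAlgebra ℂ (Matrix (Fin n) (Fin n) ℂ) := Matrix.linftyOpNormedAlgebra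
    let i₃ : NormedAlgebra ℚ (Matrix (Fin n) (Fin n) ℂ) := NormedAlgebra.restrictScalars ℚ ℂ _
    exact @map_exp_matrix n ℝ (Matrix (Fin n) (Fin n) ℂ) _ i₁ i₃ (algebraMap ℝ ℂ).mapMatrix
      (continuous_id.matrix_map Complex.continuous_ofReal) M
  have hcoord (r : ℝ) (i : Fin n) : ((opPow r A x i : ℝ) : ℂ)
      = NormedSpace.exp ((Real.log r : ℂ) • Matrix.toEuclideanCLM (𝕜 := ℂ) B) y i := by
    have hexp : NormedSpace.exp ((Real.log r : ℂ) • Matrix.toEuclideanCLM (𝕜 := ℂ) B)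
        = Matrix.toEuclideanCLM (𝕜 := ℂ)
          ((NormedSpace.exp (Real.log r • A)).map (algebraMap ℝ ℂ)) := by
      rw [hmap, toEuclideanCLM_exp, ← map_smul]
      congr 2
      ext i j
      simp [B]
    rw [hexp, opPow, Matrix.ofLp_toEuclideanCLM, Matrix.ofLp_toEuclideanCLM]
    simp [Matrix.mulVec, dotProduct, y]
  have hi (i : Fin n) : Tendsto (fun r => opPow r A x i) (𝓝[>] 0) (𝓝 0) := by
    have h := ((EuclideanSpace.proj (𝕜 := ℂ) i).continuous.tendsto 0).comp hlim
    have h' := (Complex.continuous_re.tendsto _).comp h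
    simp only [map_zero, Complex.zero_re] at h'
    refine h'.congr fun r => ?_
    exact (congrArg Complex.re (hcoord r i)).symm
  have hpi : Tendsto (fun r => WithLp.ofLp (opPow r A x)) (𝓝[>] 0) (𝓝 0) :=
    tendsto_pi_nhds.2 hi
  exact ((PiLp.continuous_toLp 2 _).tendsto 0).comp hpi

end OpPow

/-! ### A translation-equivariant location parameter for laws on the line. -/

section Scalar

/-- The mean of `arctan (x - c)` under `ν`, a strictly decreasing function of `c`. -/
def arctanMean (ν : Measure ℝ) (c : ℝ) : ℝ := ∫ x, Real.arctan (x - c) ∂ν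

/-- The location parameter of `ν`: the unique zero of `arctanMean ν`. -/
def arctanCenter (ν : Measure ℝ) : ℝ := Classical.epsilon fun c => arctanMean ν c = 0

variable (ν : Measure ℝ)

theorem norm_arctan_le (x : ℝ) : ‖Real.arctan x‖ ≤ Real.pi / 2 :=
  abs_le.2 ⟨(Real.neg_pi_div_two_lt_arctan x).le, (Real.arctan_lt_pi_div_two x).le⟩

theorem integrable_arctan_sub [IsFiniteMeasure ν] (c : ℝ) :
    Integrable (fun x => Real.arctan (x - c)) ν :=
  Integrable.of_bound (by fun_prop) (Real.pi / 2) (.of_forall fun _ => norm_arctan_le _)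

theorem arctanMean_strictAnti [IsProbabilityMeasure ν] : StrictAnti (arctanMean ν) := by
  intro a c hac
  have hlt (x : ℝ) : Real.arctan (x - c) < Real.arctan (x - a) :=
    Real.arctan_strictMono (by linarith)
  rw [← sub_pos, arctanMean, arctanMean,
    ← integral_sub (integrable_arctan_sub ν a) (integrable_arctan_sub ν c),
    integral_pos_iff_support_of_nonneg (fun x => (sub_pos.2 (hlt x)).le)
      ((integrable_arctan_sub ν a).sub (integrable_arctan_sub ν c))]
  have : Function.support (fun x => Real.arctan (x - a) - Real.arctan (x - c)) = Set.univ :=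
    Set.eq_univ_of_forall fun x => (sub_pos.2 (hlt x)).ne'
  simp [this]

theorem tendsto_arctanMean [IsProbabilityMeasure ν] {ι : Type*} {l : Filter ι}
    [l.IsCountablyGenerated] {c : ι → ℝ} {a : ℝ → ℝ}
    (h : ∀ x, Tendsto (fun i => Real.arctan (x - c i)) l (𝓝 (a x))) :
    Tendsto (fun i => arctanMean ν (c i)) l (𝓝 (∫ x, a x ∂ν)) :=
  tendsto_integral_filter_of_dominated_convergence (fun _ => Real.pi / 2)
    (.of_forall fun _ => by fun_prop) (.of_forall fun _ => .of_forall fun _ => norm_arctan_le _)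
    (integrable_const _) (.of_forall h)

/-- Intermediate value theorem: by dominated convergence the mean is continuous in `c`, with limits
`π/2` and `-π/2` at the two ends. -/
theorem exists_arctanMean_eq_zero [IsProbabilityMeasure ν] : ∃ c, arctanMean ν c = 0 := by
  have hcont : Continuous (arctanMean ν) := continuous_iff_continuousAt.2 fun c =>
    tendsto_arctanMean ν fun x =>
      (Real.continuous_arctan.comp (continuous_const.sub continuous_id)).tendsto c
  have hbot : Tendsto (arctanMean ν) atBot (𝓝 (Real.pi / 2)) := by
    simpa using tendsto_arctanMean ν (l := atBot) (c := id) (a := fun _ => Real.pi / 2) fun x =>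
      (Real.tendsto_arctan_atTop.mono_right nhdsWithin_le_nhds).comp
        (tendsto_atTop_add_const_left _ x tendsto_neg_atBot_atTop)
  have htop : Tendsto (arctanMean ν) atTop (𝓝 (-(Real.pi / 2))) := by
    simpa using tendsto_arctanMean ν (l := atTop) (c := id) (a := fun _ => -(Real.pi / 2)) fun x =>
      (Real.tendsto_arctan_atBot.mono_right nhdsWithin_le_nhds).comp
        (tendsto_atBot_add_const_left _ x tendsto_neg_atTop_atBot)
  have hpi : 0 < Real.pi / 2 := by positivity
  obtain ⟨a, ha⟩ := (hbot.eventually (lt_mem_nhds hpi)).exists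
  obtain ⟨c, hc⟩ := (htop.eventually (gt_mem_nhds (neg_lt_zero.2 hpi))).exists
  exact mem_range_of_exists_le_of_exists_ge hcont ⟨c, hc.le⟩ ⟨a, ha.le⟩

theorem arctanMean_arctanCenter [IsProbabilityMeasure ν] : arctanMean ν (arctanCenter ν) = 0 :=
  Classical.epsilon_spec (exists_arctanMean_eq_zero ν)

variable {ν}

theorem arctanCenter_eq [IsProbabilityMeasure ν] {c : ℝ} (h : arctanMean ν c = 0) :
    arctanCenter ν = c :=
  (arctanMean_strictAnti ν).injective ((arctanMean_arctanCenter ν).trans h.symm)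

theorem arctanCenter_dirac (a : ℝ) : arctanCenter (Measure.dirac a) = a :=
  arctanCenter_eq (by simp [arctanMean])

variable {Ω : Type*} [MeasurableSpace Ω] {P : Measure Ω} [IsProbabilityMeasure P]

theorem arctanCenter_map_add_const {V : Ω → ℝ} (hV : AEMeasurable V P) (a : ℝ) :
    arctanCenter (P.map fun ω => V ω + a) = arctanCenter (P.map V) + a := by
  have : IsProbabilityMeasure (P.map V) := Measure.isProbabilityMeasure_map hV
  have : IsProbabilityMeasure (P.map fun ω => V ω + a) :=
    Measure.isProbabilityMeasure_map (hV.add_const a)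
  refine arctanCenter_eq ?_
  rw [← arctanMean_arctanCenter (P.map V), arctanMean, arctanMean,
    integral_map (hV.add_const a) (by fun_prop), integral_map hV (by fun_prop)]
  simp

/-- For fixed `c` the mean is the integral of a bounded continuous function, so it converges. By
strict monotonicity its sign at `a` tells on which side of `a` the zero lies, which traps the zeros.
-/
theorem tendsto_arctanCenter {ι : Type*} {l : Filter ι} {V : ι → Ω → ℝ} {W : Ω → ℝ}
    (h : TendstoInDistribution V l W (fun _ => P) P) :
    Tendsto (fun i => arctanCenter (P.map (V i))) l (𝓝 (arctanCenter (P.map W))) := by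
  have hprob (i : ι) : IsProbabilityMeasure (P.map (V i)) :=
    Measure.isProbabilityMeasure_map (h.forall_aemeasurable i)
  have : IsProbabilityMeasure (P.map W) := Measure.isProbabilityMeasure_map h.aemeasurable_limit
  have hmean (c : ℝ) : Tendsto (fun i => arctanMean (P.map (V i)) c) l
      (𝓝 (arctanMean (P.map W) c)) :=
    ProbabilityMeasure.tendsto_iff_forall_integral_tendsto.1 h.tendsto
      (BoundedContinuousFunction.ofNormedAddCommGroup (fun x => Real.arctan (x - c))
        (by fun_prop) (Real.pi / 2) fun _ => norm_arctan_le _)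
  have hzero := arctanMean_arctanCenter (P.map W)
  refine tendsto_order.2 ⟨fun a ha => ?_, fun a ha => ?_⟩
  · have h0 := arctanMean_strictAnti (P.map W) ha
    rw [hzero] at h0
    filter_upwards [(hmean a).eventually (lt_mem_nhds h0)] with i hi
    rw [← arctanMean_arctanCenter (P.map (V i))] at hi
    exact (arctanMean_strictAnti _).lt_iff_gt.1 hi
  · have h0 := arctanMean_strictAnti (P.map W) ha
    rw [hzero] at h0
    filter_upwards [(hmean a).eventually (gt_mem_nhds h0)] with i hi
    rw [← arctanMean_arctanCenter (P.map (V i))] at hi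
    exact (arctanMean_strictAnti _).lt_iff_gt.1 hi

end Scalar

/-! ### The location parameter of random vectors. -/

section Vector

variable {Ω : Type*} [MeasurableSpace Ω] {m : ℕ}

/-- The coordinatewise location parameter of a random vector. -/
def center (P : Measure Ω) (V : Ω → EuclideanSpace ℝ (Fin m)) : EuclideanSpace ℝ (Fin m) :=
  WithLp.toLp 2 fun i => arctanCenter (P.map fun ω => V ω i)

variable {P : Measure Ω} {V W : Ω → EuclideanSpace ℝ (Fin m)}

theorem center_congr (h : IdentDistrib V W P P) : center P V = center P W := by
  ext i
  have h' := h.comp (u := fun x : EuclideanSpace ℝ (Fin m) => x i) (by fun_prop)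
  exact congrArg arctanCenter h'.map_eq

theorem center_zero [IsProbabilityMeasure P] :
    center P (fun _ => (0 : EuclideanSpace ℝ (Fin m))) = 0 := by
  ext i
  simp [center, Measure.map_const, arctanCenter_dirac]

theorem center_add_const [IsProbabilityMeasure P] (hV : AEMeasurable V P)
    (a : EuclideanSpace ℝ (Fin m)) : center P (fun ω => V ω + a) = center P V + a := by
  ext i
  exact arctanCenter_map_add_const (V := fun ω => V ω i) (by fun_prop) (a i)

theorem tendsto_center [IsProbabilityMeasure P] {ι : Type*} {l : Filter ι}
    {U : ι → Ω → EuclideanSpace ℝ (Fin m)} (h : TendstoInDistribution U l V (fun _ => P) P) :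
    Tendsto (fun i => center P (U i)) l (𝓝 (center P V)) := by
  refine ((PiLp.continuous_toLp 2 _).tendsto _).comp (tendsto_pi_nhds.2 fun j => ?_)
  exact tendsto_arctanCenter
    (h.continuous_comp (g := fun x : EuclideanSpace ℝ (Fin m) => x j) (by fun_prop))

end Vector

/-! ### Shift functions: explicit formula, cocycle identity, continuity. -/

section WideSense

variable {d m : ℕ} {Ω : Type*} [MeasurableSpace Ω] {P : Measure Ω}
  {X : EuclideanSpace ℝ (Fin d) → Ω → EuclideanSpace ℝ (Fin m)}
  {E : Matrix (Fin d) (Fin d) ℝ} {D : Matrix (Fin m) (Fin m) ℝ}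
  {b : ℝ → EuclideanSpace ℝ (Fin d) → EuclideanSpace ℝ (Fin m)}

theorem EqInLaw.identDistrib {T : Type*} {X Y : T → Ω → EuclideanSpace ℝ (Fin m)}
    (h : EqInLaw P X Y) (t : T) : IdentDistrib (X t) (Y t) P P :=
  IdentDistrib.comp h (measurable_pi_apply t)

variable [IsProbabilityMeasure P]

theorem StochasticallyContinuous.tendstoInDistribution (hX : ∀ t, Measurable (X t))
    (hc : StochasticallyContinuous P X) (t : EuclideanSpace ℝ (Fin d)) :
    TendstoInDistribution X (𝓝 t) (X t) (fun _ => P) P :=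
  (hc t).tendstoInDistribution fun s => (hX s).aemeasurable

theorem StochasticallyContinuous.continuous_center (hX : ∀ t, Measurable (X t))
    (hc : StochasticallyContinuous P X) : Continuous fun t => center P (X t) :=
  continuous_iff_continuousAt.2 fun t => tendsto_center (hc.tendstoInDistribution hX t)

theorem StochasticallyContinuous.continuous_center_clm (hX : ∀ t, Measurable (X t))
    (hc : StochasticallyContinuous P X)
    (L : EuclideanSpace ℝ (Fin m) →L[ℝ] EuclideanSpace ℝ (Fin m)) :
    Continuous fun t => center P fun ω => L (X t ω) :=
  continuous_iff_continuousAt.2 fun t =>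
    tendsto_center ((hc.tendstoInDistribution hX t).continuous_comp L.continuous)

theorem tendsto_center_clm {V : Ω → EuclideanSpace ℝ (Fin m)} (hV : Measurable V) {ι : Type*}
    {l : Filter ι} [l.IsCountablyGenerated]
    {L : ι → EuclideanSpace ℝ (Fin m) →L[ℝ] EuclideanSpace ℝ (Fin m)}
    {L₀ : EuclideanSpace ℝ (Fin m) →L[ℝ] EuclideanSpace ℝ (Fin m)}
    (h : ∀ x, Tendsto (fun i => L i x) l (𝓝 (L₀ x))) :
    Tendsto (fun i => center P fun ω => L i (V ω)) l (𝓝 (center P fun ω => L₀ (V ω))) :=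
  tendsto_center (tendstoInDistribution_of_ae_tendsto
    (fun i => ((L i).continuous.measurable.comp hV).aemeasurable)
    (L₀.continuous.measurable.comp hV).aemeasurable (.of_forall fun ω => h (V ω)))

theorem IsWOSS.center_eq (hX : ∀ t, Measurable (X t)) (h : IsWOSS P X E D b) {r : ℝ} (hr : 0 < r)
    (t : EuclideanSpace ℝ (Fin d)) :
    center P (X (opPow r E t)) = center P (fun ω => opPow r D (X t ω)) + b r t := by
  rw [center_congr ((h.eqInLaw r hr).identDistrib t), center_add_const]
  exact ((opPow r D).continuous.measurable.comp (hX t)).aemeasurable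

theorem IsWOSS.shift_eq (hX : ∀ t, Measurable (X t)) (h : IsWOSS P X E D b) {r : ℝ} (hr : 0 < r)
    (t : EuclideanSpace ℝ (Fin d)) :
    b r t = center P (X (opPow r E t)) - center P (fun ω => opPow r D (X t ω)) :=
  eq_sub_of_add_eq' (h.center_eq hX hr t).symm

/-- The center of `X((rs)^E t)` is computed in one step and in two; the common term, the center of
`(rs)^D X(t)`, cancels. -/
theorem IsWOSS.shift_mul (hX : ∀ t, Measurable (X t)) (h : IsWOSS P X E D b) {r s : ℝ}
    (hr : 0 < r) (hs : 0 < s) (t : EuclideanSpace ℝ (Fin d)) :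
    b (r * s) t = opPow r D (b s t) + b r (opPow s E t) := by
  have h₁ := (h.eqInLaw s hs).identDistrib t
  have h₂ := h₁.comp (opPow r D).continuous.measurable
  have hmeas : AEMeasurable (fun ω => opPow (r * s) D (X t ω)) P :=
    ((opPow (r * s) D).continuous.measurable.comp (hX t)).aemeasurable
  have h₃ : center P (fun ω => opPow r D (X (opPow s E t) ω))
      = center P (fun ω => opPow (r * s) D (X t ω)) + opPow r D (b s t) := by
    rw [← center_add_const hmeas]
    refine (center_congr h₂).trans (congrArg (center P) (funext fun ω => ?_))
    simp only [Function.comp_apply, map_add]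
    rw [opPow_mul_apply hr hs]
  have h₄ := h.center_eq hX (mul_pos hr hs) t
  rw [opPow_mul_apply hr hs, h.center_eq hX hr, h₃, add_assoc] at h₄
  exact (add_left_cancel h₄).symm

theorem IsWOSS.continuous_shift (hX : ∀ t, Measurable (X t)) (hc : StochasticallyContinuous P X)
    (h : IsWOSS P X E D b) {r : ℝ} (hr : 0 < r) : Continuous (b r) := by
  rw [funext fun t => h.shift_eq hX hr t]
  exact ((hc.continuous_center hX).comp (opPow r E).continuous).sub
    (hc.continuous_center_clm hX (opPow r D))

theorem IsWOSS.continuousOn_shift (hX : ∀ t, Measurable (X t))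
    (hc : StochasticallyContinuous P X) (h : IsWOSS P X E D b) (t : EuclideanSpace ℝ (Fin d)) :
    ContinuousOn (fun r => b r t) (Set.Ioi 0) := by
  refine ContinuousOn.congr ?_ fun r hr => h.shift_eq hX hr t
  refine ContinuousOn.sub ?_ fun r hr => ?_
  · exact (hc.continuous_center hX).comp_continuousOn
      ((continuousOn_opPow E).clm_apply continuousOn_const)
  · exact tendsto_center_clm (hX t) fun x =>
      ((continuousOn_opPow D).clm_apply continuousOn_const) r hr

end WideSense

/-! ### Restriction to an eigenline. -/

section EigenLine

variable {d m : ℕ}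

/-- The centering function along the line spanned by `ξ`, away from the origin. -/
def lineShift (b : ℝ → EuclideanSpace ℝ (Fin d) → EuclideanSpace ℝ (Fin m)) (lam : ℝ)
    (ξ : EuclideanSpace ℝ (Fin d)) (u : ℝ) : EuclideanSpace ℝ (Fin m) :=
  b (|u| ^ lam⁻¹) ((SignType.sign u : ℝ) • ξ)

variable {Ω : Type*} [MeasurableSpace Ω] {P : Measure Ω} [IsProbabilityMeasure P]
  {X : EuclideanSpace ℝ (Fin d) → Ω → EuclideanSpace ℝ (Fin m)}
  {E : Matrix (Fin d) (Fin d) ℝ} {D : Matrix (Fin m) (Fin m) ℝ}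
  {b : ℝ → EuclideanSpace ℝ (Fin d) → EuclideanSpace ℝ (Fin m)}
  {lam : ℝ} {ξ : EuclideanSpace ℝ (Fin d)}

theorem opPow_smul_eigenvector (hξ : Matrix.toEuclideanCLM (𝕜 := ℝ) E ξ = lam • ξ) {r : ℝ}
    (hr : 0 < r) (c : ℝ) : opPow r E (c • ξ) = (c * r ^ lam) • ξ := by
  rw [map_smul, opPow_apply_eigenvector hξ hr, smul_smul]

theorem opPow_abs_rpow_sign (hlam : 0 < lam)
    (hξ : Matrix.toEuclideanCLM (𝕜 := ℝ) E ξ = lam • ξ) {u : ℝ} (hu : u ≠ 0) :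
    opPow (|u| ^ lam⁻¹) E ((SignType.sign u : ℝ) • ξ) = u • ξ := by
  rw [opPow_smul_eigenvector hξ (Real.rpow_pos_of_pos (abs_pos.2 hu) _),
    Real.rpow_inv_rpow (abs_nonneg u) hlam.ne', sign_mul_abs]

theorem IsWOSS.shift_smul_eigenvector (hX : ∀ t, Measurable (X t)) (h : IsWOSS P X E D b)
    (hlam : 0 < lam) (hξ : Matrix.toEuclideanCLM (𝕜 := ℝ) E ξ = lam • ξ) {u : ℝ} (hu : u ≠ 0)
    {r : ℝ} (hr : 0 < r) :
    b r (u • ξ) = lineShift b lam ξ (u * r ^ lam) - opPow r D (lineShift b lam ξ u) := by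
  have hpos : 0 < r ^ lam := Real.rpow_pos_of_pos hr lam
  have habs : |u * r ^ lam| ^ lam⁻¹ = r * |u| ^ lam⁻¹ := by
    rw [abs_mul, abs_of_pos hpos, Real.mul_rpow (abs_nonneg u) hpos.le,
      Real.rpow_rpow_inv hr.le hlam.ne', mul_comm]
  have hsign : SignType.sign (u * r ^ lam) = SignType.sign u := by
    rw [sign_mul, sign_pos hpos, mul_one]
  rw [lineShift, lineShift, habs, hsign,
    h.shift_mul hX hr (Real.rpow_pos_of_pos (abs_pos.2 hu) _), opPow_abs_rpow_sign hlam hξ hu,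
    add_sub_cancel_left]

theorem IsWOSS.continuousOn_lineShift (hX : ∀ t, Measurable (X t))
    (hc : StochasticallyContinuous P X) (h : IsWOSS P X E D b) :
    ContinuousOn (lineShift b lam ξ) {0}ᶜ := by
  intro u hu
  have hu : u ≠ 0 := hu
  refine ContinuousAt.continuousWithinAt ?_
  have hpow : ContinuousAt (fun v : ℝ => |v| ^ lam⁻¹) u :=
    continuous_abs.continuousAt.rpow_const (Or.inl (abs_ne_zero.2 hu))
  have hb : ContinuousAt (fun r => b r ((SignType.sign u : ℝ) • ξ)) (|u| ^ lam⁻¹) :=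
    (h.continuousOn_shift hX hc _).continuousAt
      (Ioi_mem_nhds (Real.rpow_pos_of_pos (abs_pos.2 hu) _))
  refine (ContinuousAt.comp (f := fun v : ℝ => |v| ^ lam⁻¹) hb hpow).congr ?_
  -- The sign is locally constant off `0`, so only continuity of `b` in the scale is needed.
  have hsign : ∀ᶠ v in 𝓝 u, SignType.sign v = SignType.sign u := by
    rcases hu.lt_or_gt with hneg | hpos
    · filter_upwards [gt_mem_nhds hneg] with v hv
      rw [sign_neg hv, sign_neg hneg]
    · filter_upwards [lt_mem_nhds hpos] with v hv
      rw [sign_pos hv, sign_pos hpos]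
  filter_upwards [hsign] with v hv
  simp [lineShift, hv]

theorem IsWOSS.tendsto_lineShift (hX : ∀ t, Measurable (X t))
    (hc : StochasticallyContinuous P X) (h : IsWOSS P X E D b) (hD : MemQ D) (hlam : 0 < lam)
    (hξ : Matrix.toEuclideanCLM (𝕜 := ℝ) E ξ = lam • ξ) :
    Tendsto (lineShift b lam ξ) (𝓝[≠] 0) (𝓝 (center P (X 0))) := by
  have hscale : Tendsto (fun u : ℝ => |u| ^ lam⁻¹) (𝓝[≠] 0) (𝓝[>] 0) := by
    refine tendsto_nhdsWithin_iff.2 ⟨?_, ?_⟩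
    · have hcont : Continuous fun u : ℝ => |u| ^ lam⁻¹ :=
        continuous_abs.rpow_const fun _ => Or.inr (inv_pos.2 hlam).le
      have h0 := hcont.tendsto 0
      rw [abs_zero, Real.zero_rpow (inv_pos.2 hlam).ne'] at h0
      exact h0.mono_left nhdsWithin_le_nhds
    · filter_upwards [self_mem_nhdsWithin] with u hu
      exact Real.rpow_pos_of_pos (abs_pos.2 hu) _
  have hvanish (c : ℝ) : Tendsto
      (fun u : ℝ => center P fun ω => opPow (|u| ^ lam⁻¹) D (X (c • ξ) ω)) (𝓝[≠] 0) (𝓝 0) := by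
    have := tendsto_center_clm (P := P) (hX (c • ξ)) (L₀ := 0)
      fun x => (tendsto_opPow_apply hD x).comp hscale
    simpa [center_zero] using this
  have hsigned : Tendsto (fun u : ℝ => center P fun ω =>
      opPow (|u| ^ lam⁻¹) D (X ((SignType.sign u : ℝ) • ξ) ω)) (𝓝[≠] 0) (𝓝 0) := by
    -- `sign(u) ξ` takes only the values `±ξ`, so each side of `0` involves a single random vector.
    rw [← Set.Iio_union_Ioi, nhdsWithin_union, tendsto_sup]
    refine ⟨((hvanish (-1)).mono_left (nhdsWithin_mono 0 fun u hu => ne_of_lt hu)).congr' ?_,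
      ((hvanish 1).mono_left (nhdsWithin_mono 0 fun u hu => ne_of_gt hu)).congr' ?_⟩
    · filter_upwards [self_mem_nhdsWithin] with u hu
      simp [sign_neg (Set.mem_Iio.1 hu)]
    · filter_upwards [self_mem_nhdsWithin] with u hu
      simp [sign_pos (Set.mem_Ioi.1 hu)]
  have hline : Tendsto (fun u : ℝ => center P (X (u • ξ))) (𝓝[≠] 0) (𝓝 (center P (X 0))) := by
    have h0 := ((hc.continuous_center hX).comp (continuous_id.smul continuous_const)).tendsto
      (0 : ℝ) (f := fun u : ℝ => center P (X (u • ξ)))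
    rw [zero_smul] at h0
    exact h0.mono_left nhdsWithin_le_nhds
  have hdiff := hline.sub hsigned
  rw [sub_zero] at hdiff
  refine hdiff.congr' ?_
  filter_upwards [self_mem_nhdsWithin] with u hu
  rw [lineShift, h.shift_eq hX (Real.rpow_pos_of_pos (abs_pos.2 hu) _),
    opPow_abs_rpow_sign hlam hξ hu]

/-- If the shifts along the line spanned by `ξ` are a coboundary of a continuous function `g`
away from the origin, then subtracting `g` yields an operator-self-similar process. -/
theorem IsWOSS.isOneParamOSS_sub (hX : ∀ t, Measurable (X t))
    (hc : StochasticallyContinuous P X) (h : IsWOSS P X E D b) (hlam : 0 < lam)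
    (hξ : Matrix.toEuclideanCLM (𝕜 := ℝ) E ξ = lam • ξ)
    {g : ℝ → EuclideanSpace ℝ (Fin m)} (hg : Continuous g)
    (hbg : ∀ u : ℝ, u ≠ 0 → ∀ r : ℝ, 0 < r → b r (u • ξ) = g (u * r ^ lam) - opPow r D (g u)) :
    IsOneParamOSS P (fun u ω => X (u • ξ) ω - g u) (lam⁻¹ • D) := by
  intro r hr
  have hs : 0 < r ^ lam⁻¹ := Real.rpow_pos_of_pos hr _
  have hsr : (r ^ lam⁻¹) ^ lam = r := Real.rpow_inv_rpow hr.le hlam.ne'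
  rw [opPow_smul _ _ _ hr]
  -- The formula reaches `u = 0` because both sides are continuous and agree on a dense set.
  have hcob (u : ℝ) : b (r ^ lam⁻¹) (u • ξ) = g (u * r) - opPow (r ^ lam⁻¹) D (g u) := by
    have hleft : Continuous fun u : ℝ => b (r ^ lam⁻¹) (u • ξ) :=
      (h.continuous_shift hX hc hs).comp (continuous_id.smul continuous_const)
    have hright : Continuous fun u : ℝ => g (u * r) - opPow (r ^ lam⁻¹) D (g u) :=
      (hg.comp (continuous_mul_const r)).sub ((opPow (r ^ lam⁻¹) D).continuous.comp hg)
    refine congrFun (hleft.ext_on (dense_compl_singleton (0 : ℝ)) hright fun v hv => ?_) u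
    have := hbg v hv _ hs
    rwa [hsr] at this
  -- Restricting to the line and subtracting `g (u * r)` is a measurable map of path spaces, so it
  -- preserves equality in law of whole fields.
  have hmeas : Measurable fun (x : EuclideanSpace ℝ (Fin d) → EuclideanSpace ℝ (Fin m)) (u : ℝ) =>
      x (u • ξ) - g (u * r) :=
    measurable_pi_lambda _ fun u => (measurable_pi_apply (u • ξ)).sub_const _
  have hlaw := IdentDistrib.comp (h.eqInLaw _ hs) hmeas
  unfold EqInLaw
  convert hlaw using 1
  · funext ω u
    simp only [Function.comp_apply]
    rw [opPow_smul_eigenvector hξ hs, hsr, mul_comm r u]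
  · funext ω u
    simp only [Function.comp_apply]
    rw [hcob, map_sub]
    abel

end EigenLine

end OpSelfSimilar

end

theorem mainTheorem9 {d m : ℕ} (hd : 2 ≤ d) (hm : 2 ≤ m)
    {Ω : Type*} [MeasurableSpace Ω] (P : Measure Ω) [IsProbabilityMeasure P]
    (X : EuclideanSpace ℝ (Fin d) → Ω → EuclideanSpace ℝ (Fin m))
    (hX_meas : ∀ t, Measurable (X t))
    (hX_cont : OpSelfSimilar.StochasticallyContinuous P X)
    (hX_proper : OpSelfSimilar.IsProper P X)
    (E : Matrix (Fin d) (Fin d) ℝ) (D : Matrix (Fin m) (Fin m) ℝ)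
    (b : ℝ → EuclideanSpace ℝ (Fin d) → EuclideanSpace ℝ (Fin m))
    (hX_woss : OpSelfSimilar.IsWOSS P X E D b)
    (lam : ℝ) (hlam_pos : 0 < lam)
    (hlam : Module.End.HasEigenvalue (Matrix.toLin' E) lam)
    (ξ : EuclideanSpace ℝ (Fin d))
    (hξ : Matrix.toEuclideanCLM (𝕜 := ℝ) E ξ = lam • ξ) :
    ∃ f : ℝ → EuclideanSpace ℝ (Fin m),
      ContinuousOn f {0}ᶜ ∧
      (∀ u : ℝ, u ≠ 0 → ∀ r : ℝ, 0 < r →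
        b r (u • ξ) = f (u * r ^ lam) - OpSelfSimilar.opPow r D (f u)) ∧
      (OpSelfSimilar.MemQ D →
        ∃ g : ℝ → EuclideanSpace ℝ (Fin m),
          Continuous g ∧ Set.EqOn g f {0}ᶜ ∧
          OpSelfSimilar.IsOneParamOSS P (fun u ω => X (u • ξ) ω - g u) (lam⁻¹ • D)) := by
  have hcob : ∀ u : ℝ, u ≠ 0 → ∀ r : ℝ, 0 < r → b r (u • ξ)
      = OpSelfSimilar.lineShift b lam ξ (u * r ^ lam)
        - OpSelfSimilar.opPow r D (OpSelfSimilar.lineShift b lam ξ u) := fun u hu r hr =>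
    hX_woss.shift_smul_eigenvector hX_meas hlam_pos hξ hu hr
  have hcont : ContinuousOn (OpSelfSimilar.lineShift b lam ξ) {0}ᶜ :=
    hX_woss.continuousOn_lineShift hX_meas hX_cont
  refine ⟨OpSelfSimilar.lineShift b lam ξ, hcont, hcob, fun hD => ?_⟩
  -- The value at `0` is the limit supplied by `IsWOSS.tendsto_lineShift`.
  set g := Function.update (OpSelfSimilar.lineShift b lam ξ) 0 (OpSelfSimilar.center P (X 0))
  have hg : Continuous g := continuous_iff_continuousAt.2 fun u => by
    rcases eq_or_ne u 0 with rfl | hu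
    · exact continuousAt_update_same.2
        (hX_woss.tendsto_lineShift hX_meas hX_cont hD hlam_pos hξ)
    · exact (continuousAt_update_of_ne hu).2
        (hcont.continuousAt (isOpen_compl_singleton.mem_nhds hu))
  have heq : ∀ u : ℝ, u ≠ 0 → g u = OpSelfSimilar.lineShift b lam ξ u := fun u hu =>
    Function.update_of_ne hu _ _
  refine ⟨g, hg, fun u hu => heq u hu,
    hX_woss.isOneParamOSS_sub hX_meas hX_cont hlam_pos hξ hg fun u hu r hr => ?_⟩
  rw [heq u hu, heq _ (mul_ne_zero hu (Real.rpow_pos_of_pos hr lam).ne'), hcob u hu r hr]
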